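/- Let $N\ge 2$, $0\le n\le N$, $\mathbf P=\mathbb C[t_1,\dots,t_N]$, and let $\Lambda_n$ be the set of words $\lambda\in\{0,1\}^N$ with exactly $n$ letters $1$. The group $S_N$ acts on $\Lambda_n$ by $(w\lambda)_j=\lambda_{w^{-1}(j)}$. Let $\ell(\lambda)=\#\{i<j : \lambda_i>\lambda_j\}$. Write $\mu\ge\lambda$ if $\sum_{i\le j}\mu_i\ge\sum_{i\le j}\lambda_i$ for all $j$, and $\mu\ge_w\lambda$ if $w^{-1}\mu\ge w^{-1}\lambda$. Via restriction to torus fixed points, the $T$-equivariant cohomology $H_T^*(\mathrm{Gr}(n,N))$ (coefficients in $\mathbb C$) is identified with the $\mathbf P$-module of all functions $\alpha:\Lambda_n\to\mathbf P$ such that $t_i-t_j$ divides $\alpha(\lambda)-\alpha(s_{ij}\lambda)$ for all $\lambda\in\Lambda_n$ and all transpositions $s_{ij}$. For $w\in S_N$ and $\lambda\in\Lambda_n$, the $w$-twisted equivariant Schubert class $S^w_\lambda$ is the class $\alpha\in H_T^*(\mathrm{Gr}(n,N))$ such that: $\alpha(\lambda)\neq 0$, and $\alpha(\mu)=0$ unless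 $\mu\ge_w\lambda$; $\alpha(\lambda)=\prod(t_i-t_j)$, the product over all $(i,j)$ with $w^{-1}(i)<w^{-1}(j)$ and $\lambda_i>\lambda_j$; and $\deg\alpha(\mu)=\ell(w^{-1}\lambda)$ for all $\mu\ge_w\lambda$. Then the following hold. 1. For all $w\in S_N$ and $\lambda\in\Lambda_n$ there is exactly one such class $S^w_\lambda$. 2. For all $w\in S_N$, all simple transpositions $s=s_i=(i,i+1)$ and all $\lambda,\mu\in\Lambda_n$, $$S^{ws}_\lambda(\mu)=\begin{cases}S^w_{wsw^{-1}(\lambda)}(\mu)+(t_{w(i+1)}-t_{w(i)})\,S^w_\lambda(\mu)&\text{if }\lambda_{w(i+1)}>\lambda_{w(i)},\\ S^w_{wsw^{-1}(\lambda)}(\mu)&\text{otherwise.}\end{cases}$$ 3. For every $w\in S_N$, the family $\{S^w_\lambda\}_{\lambda\in\Lambda_n}$ is a $\mathbf P$-basis of $H_T^*(\mathrm{Gr}(n,N))$. 4. Let $V=\mathbb C^2$ with basis $v_0,v_1$, and let $v_\lambda=v_{\lambda_1}\otimes\cdots\otimes v_{\lambda_N}\in V^{\otimes N}\otimes\mathbf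 P$ for $\lambda\in\{0,1\}^N$. In the ordered basis $v_0\otimes v_0,\ v_0\otimes v_1,\ v_1\otimes v_0,\ v_1\otimes v_1$ of $V\otimes V$ let $$R(x,y)=\begin{pmatrix}1&0&0&0\\0&x-y&1&0\\0&1&0&0\\0&0&0&1\end{pmatrix}.$$ For $w\in S_N$ and $1\le i\le N-1$ put $a=w(i)$, $b=w(i+1)$, and let $R_{a,b}(t_b,t_a)$ be $R(t_b,t_a)$ acting on the $a$-th (first) and $b$-th (second) tensor factors of $V^{\otimes N}\otimes\mathbf P$. Then the base change from $\{S^{ws_i}_\lambda\}$ to $\{S^w_\lambda\}$ is given by $R_{a,b}(t_b,t_a)$: if $S^{ws_i}_\lambda=\sum_{\mu\in\Lambda_n}c_{\mu\lambda}S^w_\mu$ with $c_{\mu\lambda}\in\mathbf P$, then $R_{a,b}(t_b,t_a)\,v_\lambda=\sum_{\mu\in\Lambda_n}c_{\mu\lambda}v_\mu$ for all $\lambda\in\Lambda_n$. -/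

import Mathlib

open scoped TensorProduct

namespace WallCrossing

/-- The polynomial ring `P = ℂ[t_1, …, t_N]`; the variable `t_i` is `MvPolynomial.X i`.
Indices run over `Fin N`, so they start at `0`. -/
abbrev P (N : ℕ) : Type := MvPolynomial (Fin N) ℂ

/-! ### Words -/

/-- The set `Λ_n` of words `λ` of length `N` in the letters `0, 1` with exactly `n` letters `1`. -/
abbrev Word (N n : ℕ) : Type := {l : Fin N → Fin 2 // ∑ i, (l i : ℕ) = n}

/-- The action of the symmetric group on words: `(w λ)_j = λ_{w⁻¹(j)}`. -/
def Word.act {N n : ℕ} (w : Equiv.Perm (Fin N)) (l : Word N n) : Word N n :=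
  ⟨fun j => l.1 (w⁻¹ j),
    (Equiv.sum_comp (w⁻¹) (fun j => (l.1 j : ℕ))).trans l.2⟩

/-- The number `ℓ(λ)` of inversions, i.e. of pairs `i < j` with `λ_i > λ_j`. -/
def Word.length {N n : ℕ} (l : Word N n) : ℕ :=
  (Finset.univ.filter fun p : Fin N × Fin N => p.1 < p.2 ∧ l.1 p.2 < l.1 p.1).card

/-- The twisted inversion set: pairs `(i, j)` with `w⁻¹(i) < w⁻¹(j)` and `λ_i > λ_j`. -/
def Word.inv {N n : ℕ} (w : Equiv.Perm (Fin N)) (l : Word N n) : Finset (Fin N × Fin N) :=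
  Finset.univ.filter fun p : Fin N × Fin N => w⁻¹ p.1 < w⁻¹ p.2 ∧ l.1 p.2 < l.1 p.1

/-- The order `μ ≥ λ` : every initial segment of `μ` has at least as many letters `1` as the one
of `λ`. -/
def Word.GE {N n : ℕ} (m l : Word N n) : Prop :=
  ∀ j : Fin N, ∑ i ∈ Finset.Iic j, (l.1 i : ℕ) ≤ ∑ i ∈ Finset.Iic j, (m.1 i : ℕ)

/-- The twisted order: `μ ≥_w λ` iff `w⁻¹(μ) ≥ w⁻¹(λ)`. -/
def Word.twistedGE {N n : ℕ} (w : Equiv.Perm (Fin N)) (m l : Word N n) : Prop :=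
  Word.GE (Word.act w⁻¹ m) (Word.act w⁻¹ l)

/-! ### Equivariant cohomology of the Grassmannian and twisted Schubert classes -/

/-- The `T`-equivariant cohomology `H_T^*(Gr(n, N))`, seen through restriction to the torus fixed
points `ℂ^λ` as the `P`-module of the functions `Λ_n → P` that satisfy the
Goresky–Kottwitz–MacPherson conditions. -/
def HT (N n : ℕ) : Submodule (P N) (Word N n → P N) where
  carrier := {α | ∀ (i j : Fin N), i ≠ j → ∀ l : Word N n,
    (MvPolynomial.X i - MvPolynomial.X j : P N) ∣ α l - α (Word.act (Equiv.swap i j) l)}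
  zero_mem' := fun i j _ l => by simp
  add_mem' := fun {α β} hα hβ i j hij l => by
    have h := dvd_add (hα i j hij l) (hβ i j hij l)
    have e : (α + β) l - (α + β) (Word.act (Equiv.swap i j) l)
        = (α l - α (Word.act (Equiv.swap i j) l)) + (β l - β (Word.act (Equiv.swap i j) l)) := by
      simp only [Pi.add_apply]; ring
    rw [e]; exact h
  smul_mem' := fun c α hα i j hij l => by
    have h := Dvd.dvd.mul_left (hα i j hij l) c
    have e : (c • α) l - (c • α) (Word.act (Equiv.swap i j) l)
        = c * (α l - α (Word.act (Equiv.swap i j) l)) := by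
      simp only [Pi.smul_apply, smul_eq_mul]; ring
    rw [e]; exact h

/-- `α` has `w`-support above `λ`: it does not vanish at `λ`, and it vanishes at every `μ` that
does not satisfy `μ ≥_w λ`. -/
def HasSupportAbove {N n : ℕ} (w : Equiv.Perm (Fin N)) (l : Word N n) (α : Word N n → P N) : Prop :=
  α l ≠ 0 ∧ ∀ m, α m ≠ 0 → Word.twistedGE w m l

/-- The conditions that characterise the `w`-twisted equivariant Schubert class of `λ`: it is a
class, it has `w`-support above `λ`, its value at `λ` is the product of the weights `t_i - t_j`
over the twisted inversions, and its values above `λ` have degree `ℓ(w⁻¹ λ)`. -/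
structure IsTwistedSchubertClass {N n : ℕ} (w : Equiv.Perm (Fin N)) (l : Word N n)
    (α : Word N n → P N) : Prop where
  isClass : α ∈ HT N n
  support : HasSupportAbove w l α
  value : α l = ∏ p ∈ Word.inv w l, (MvPolynomial.X p.1 - MvPolynomial.X p.2)
  degree : ∀ m, Word.twistedGE w m l →
    (α m).totalDegree = Word.length (Word.act w⁻¹ l)

/-- The `w`-twisted equivariant Schubert class `S^w_λ`: the function with the properties listed in
`IsTwistedSchubertClass`. -/
noncomputable def S {N n : ℕ} (w : Equiv.Perm (Fin N)) (l : Word N n) : Word N n → P N :=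
  Classical.epsilon fun α => IsTwistedSchubertClass w l α

/-! ### The `R`-matrix -/

/-- The `R`-matrix `R(x, y)` in the ordered basis
`v_0 ⊗ v_0, v_0 ⊗ v_1, v_1 ⊗ v_0, v_1 ⊗ v_1` of `V ⊗ V`. -/
def RMatrix {A : Type*} [CommRing A] (x y : A) : Matrix (Fin 2 × Fin 2) (Fin 2 × Fin 2) A :=
  (!![1, 0, 0, 0;
      0, x - y, 1, 0;
      0, 1, 0, 0;
      0, 0, 0, 1] : Matrix (Fin 4) (Fin 4) A).submatrix
    (finProdFinEquiv (m := 2) (n := 2)) (finProdFinEquiv (m := 2) (n := 2))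

/-- `V^{⊗N} ⊗ P` with `V = ℂ²`, as the `N`-fold tensor power over `P` of the free module `P²`. -/
abbrev VN (N : ℕ) : Type := ⨂[P N] _ : Fin N, (Fin 2 → P N)

/-- The standard basis `v_λ = v_{λ_1} ⊗ ⋯ ⊗ v_{λ_N}`, `λ ∈ {0, 1}^N`, of `V^{⊗N} ⊗ P`. -/
noncomputable def stdBasis (N : ℕ) : Module.Basis (Fin N → Fin 2) (P N) (VN N) :=
  Basis.piTensorProduct fun _ => Pi.basisFun (P N) (Fin 2)

/-- The operator `f_a ⊗ g_b`: it acts by `f` on the tensor factor `a`, by `g` on the tensor factor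
`b` (with `a ≠ b`) and by the identity on the others. -/
noncomputable def onFactors {N : ℕ} (a b : Fin N)
    (f g : (Fin 2 → P N) →ₗ[P N] (Fin 2 → P N)) : VN N →ₗ[P N] VN N :=
  PiTensorProduct.map fun c => if c = a then f else if c = b then g else LinearMap.id

/-- For a matrix `M` of an endomorphism of `V ⊗ V`, with `M = ∑ M_{(k,l),(p,q)} E_{kp} ⊗ E_{lq}`,
the operator `M_{a,b}` that acts by `M` on the tensor factors `a` (first) and `b` (second), and by
the identity on the others. -/
noncomputable def actOnFactors {N : ℕ} (a b : Fin N)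
    (M : Matrix (Fin 2 × Fin 2) (Fin 2 × Fin 2) (P N)) : VN N →ₗ[P N] VN N :=
  ∑ k : Fin 2, ∑ l : Fin 2, ∑ p : Fin 2, ∑ q : Fin 2,
    M (k, l) (p, q) • onFactors a b
      (Matrix.toLin' (Matrix.single k p (1 : P N))) (Matrix.toLin' (Matrix.single l q (1 : P N)))

end WallCrossing

/-! Everything reduces to `w = 1`. The symmetric group acts on functions `Λ_n → P` through words and
variables at once (`twist`). This action preserves the divisibility conditions and carries
`u`-twisted classes to `v * u`-twisted ones, so `S^w_λ` is `w` applied to the untwisted class of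
`w⁻¹λ` (`S_eq_twist`).

For `w = 1`, uniqueness is a degree argument. At a shortest word `m` of its support, a class is
divisible by the weights of all `ℓ(m)` inversions, because swapping an inversion leads to a shorter
word. Hence a class whose degree at each `m` of its support is below `ℓ(m)` vanishes
(`HT.eq_zero_of_totalDegree_lt`). For existence, the longest word `1…10…0` carries a class supported
at one point, and the divided differences `α ↦ (α - sα)/(t_i - t_{i+1})` descend from it to all
other words.

This construction is already the wall-crossing formula at a descent. At an ascent the class is
`s`-invariant, being a divided difference itself; at equal letters its divided difference has too
small a degree to be nonzero. The exact degrees require nonzero localisations: by the resulting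
recursion, the value at `m` evaluated at `t = m` is a positive integer whenever `m ≥ λ`
(`schubert_localisation`).

The basis property is triangular elimination along `ℓ`, and the `R`-matrix is the wall-crossing
formula written in coordinates. -/

namespace WallCrossing

section

variable {N n : ℕ}

/-! ### Words, prefix sums and lengths -/

theorem Word.act_apply (w : Equiv.Perm (Fin N)) (l : Word N n) (j : Fin N) :
    (Word.act w l).1 j = l.1 (w⁻¹ j) := rfl

@[simp]
theorem Word.act_one (l : Word N n) : Word.act 1 l = l := by
  apply Subtype.ext; funext j; simp [Word.act_apply]

theorem Word.act_act (w v : Equiv.Perm (Fin N)) (l : Word N n) :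
    Word.act w (Word.act v l) = Word.act (w * v) l := by
  apply Subtype.ext; funext j; simp [Word.act_apply]

/-- The number of letters `1` among the positions up to `j`. -/
def Word.pre (l : Word N n) (j : Fin N) : ℕ := ∑ i ∈ Finset.Iic j, (l.1 i : ℕ)

theorem Word.GE.refl (l : Word N n) : Word.GE l l := fun _ => le_rfl

theorem Word.letter_cases (l : Word N n) (i : Fin N) : l.1 i = 0 ∨ l.1 i = 1 := by
  have := (l.1 i).isLt
  rcases h : l.1 i with ⟨v, hv⟩
  interval_cases v <;> simp

theorem Word.eq_of_pre_eq {l m : Word N n} (h : ∀ j, l.pre j = m.pre j) : l = m := by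
  apply Subtype.ext; funext j
  induction j using WellFoundedLT.induction with
  | ind j ih =>
    have hj := h j
    have hs : ∑ i ∈ Finset.Iio j, (l.1 i : ℕ) = ∑ i ∈ Finset.Iio j, (m.1 i : ℕ) :=
      Finset.sum_congr rfl fun i hi => by rw [ih i (Finset.mem_Iio.1 hi)]
    unfold Word.pre at hj
    rw [← Finset.Iio_insert, Finset.sum_insert (by simp), Finset.sum_insert (by simp), hs] at hj
    exact Fin.ext (by omega)

/-- The prefix sums together count the pairs `i ≤ j` with `l_i = 1`. Those with `l_j = 0` are the
inversions; those with `l_j = 1` number `n(n+1)/2`. Consequently `GE` forces an inequality of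
lengths, strict unless the words agree. -/
theorem Word.sum_pre (l : Word N n) :
    2 * (l.length : ℤ) + n ^ 2 + n = 2 * ∑ j, (l.pre j : ℤ) := by
  set f : Fin N → ℤ := fun i => ((l.1 i : ℕ) : ℤ) with hf
  have hsum : ∑ i, f i = n := by
    have := l.2
    simp only [hf]; exact_mod_cast this
  have hsq : ∀ i, f i * f i = f i := fun i => by
    rcases l.letter_cases i with h | h <;> simp [hf, h]
  have hlen : (l.length : ℤ) = ∑ j, ∑ i, if i < j then f i * (1 - f j) else 0 := by
    unfold Word.length
    rw [Finset.card_filter, Nat.cast_sum, ← Finset.univ_product_univ, Finset.sum_product,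
      Finset.sum_comm]
    refine Finset.sum_congr rfl fun j _ => Finset.sum_congr rfl fun i _ => ?_
    by_cases hij : i < j
    · rcases l.letter_cases i with h | h <;> rcases l.letter_cases j with h' | h' <;>
        simp [hf, h, h', hij]
    · simp [hij]
  have hpre : ∀ j, (l.pre j : ℤ) = ∑ i, if i ≤ j then f i else 0 := fun j => by
    unfold Word.pre
    rw [Nat.cast_sum, ← Finset.sum_filter]
    congr 1
    ext; simp
  have hsymm : ∑ j, ∑ i, (if i ≤ j then f i * f j else 0)
      = ∑ j, ∑ i, (if j ≤ i then f i * f j else 0) := by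
    rw [Finset.sum_comm]
    simp only [mul_comm]
  have hall : ∑ j, ∑ i, (if i ≤ j then f i * f j else 0)
      + ∑ j, ∑ i, (if j ≤ i then f i * f j else 0) = n ^ 2 + n := by
    rw [← Finset.sum_add_distrib]
    have : ∀ j, ∑ i, (if i ≤ j then f i * f j else 0) + ∑ i, (if j ≤ i then f i * f j else 0)
        = n * f j + f j := fun j => by
      trans ∑ i, (f i * f j + if i = j then f i * f j else 0)
      swap
      · rw [Finset.sum_add_distrib, ← hsum, Finset.sum_mul]
        simp [hsq]
      rw [← Finset.sum_add_distrib]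
      refine Finset.sum_congr rfl fun i _ => ?_
      rcases lt_trichotomy i j with h | h | h
      · simp [h.le, h.not_ge, h.ne]
      · simp [h]
      · simp [h.le, h.not_ge, h.ne']
    rw [Finset.sum_congr rfl fun j _ => this j, Finset.sum_add_distrib, ← Finset.mul_sum, hsum]
    ring
  have hsplit : ∑ j, (l.pre j : ℤ)
      = l.length + ∑ j, ∑ i, (if i ≤ j then f i * f j else 0) := by
    rw [hlen, ← Finset.sum_add_distrib]
    refine Finset.sum_congr rfl fun j _ => ?_
    rw [hpre, ← Finset.sum_add_distrib]
    refine Finset.sum_congr rfl fun i _ => ?_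
    rcases lt_trichotomy i j with h | h | h
    · simp [h.le, h]; ring
    · simp [h, hsq]
    · simp [h.not_ge, h.not_gt]
  rw [hsplit]
  linarith

theorem Word.GE.length_le {m l : Word N n} (h : Word.GE m l) : l.length ≤ m.length := by
  have h1 := l.sum_pre
  have h2 := m.sum_pre
  have : ∑ j, (l.pre j : ℤ) ≤ ∑ j, (m.pre j : ℤ) :=
    Finset.sum_le_sum fun j _ => by exact_mod_cast h j
  zify; linarith

theorem Word.GE.eq_of_length_le {m l : Word N n} (h : Word.GE m l) (hl : m.length ≤ l.length) :
    m = l := by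
  have h1 := l.sum_pre
  have h2 := m.sum_pre
  have h3 : ∀ j ∈ Finset.univ, (l.pre j : ℤ) ≤ (m.pre j : ℤ) :=
    fun j _ => by exact_mod_cast h j
  have h4 : ∑ j, (l.pre j : ℤ) = ∑ j, (m.pre j : ℤ) :=
    le_antisymm (Finset.sum_le_sum h3) (by zify at hl; linarith)
  have h5 := (Finset.sum_eq_sum_iff_of_le h3).1 h4
  exact Word.eq_of_pre_eq fun j => by exact_mod_cast (h5 j (Finset.mem_univ j)).symm

/-- The effect of a transposition on the prefix sums. -/
theorem Word.pre_swap (l : Word N n) {a b : Fin N} (hab : a < b) (k : Fin N) :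
    ((Word.act (Equiv.swap a b) l).pre k : ℤ) =
      l.pre k + if a ≤ k ∧ k < b then ((l.1 b : ℕ) : ℤ) - (l.1 a : ℕ) else 0 := by
  have hpre : ∀ l : Word N n, (l.pre k : ℤ) = ∑ i, if i ≤ k then ((l.1 i : ℕ) : ℤ) else 0 :=
    fun l => by
      unfold Word.pre
      rw [Nat.cast_sum, ← Finset.sum_filter]
      congr 1
      ext; simp
  rw [hpre, hpre, ← sub_eq_iff_eq_add', ← Finset.sum_sub_distrib,
    Finset.sum_eq_add a b hab.ne (fun c _ hc => ?_) (by simp) (by simp)]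
  · simp only [Word.act_apply, Equiv.swap_inv, Equiv.swap_apply_left, Equiv.swap_apply_right]
    by_cases h1 : a ≤ k <;> by_cases h2 : b ≤ k
    · simp [h1, h2, h2.not_gt]
    · simp [h1, h2, not_le.1 h2]
    · exact absurd (hab.le.trans h2) h1
    · simp [h1, h2]
  · simp [Word.act_apply, Equiv.swap_apply_of_ne_of_ne hc.1 hc.2]

theorem Word.length_swap_lt (l : Word N n) {a b : Fin N} (hab : a < b) (h : l.1 b < l.1 a) :
    (Word.act (Equiv.swap a b) l).length < l.length := by
  have h1 := l.sum_pre
  have h2 := (Word.act (Equiv.swap a b) l).sum_pre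
  have h' : ((l.1 b : ℕ) : ℤ) < (l.1 a : ℕ) := by exact_mod_cast h
  have : ∑ j, ((Word.act (Equiv.swap a b) l).pre j : ℤ) < ∑ j, (l.pre j : ℤ) := by
    refine Finset.sum_lt_sum (fun j _ => ?_) ⟨a, Finset.mem_univ a, ?_⟩
    · rw [Word.pre_swap l hab]; split_ifs <;> linarith
    · rw [Word.pre_swap l hab, if_pos ⟨le_rfl, hab⟩]; linarith
  zify; linarith

theorem adj_lt {i j : Fin N} (hij : (i : ℕ) + 1 = j) : i < j := by
  rw [Fin.lt_def]; omega

theorem Word.pre_swap_adj (l : Word N n) {i j : Fin N} (hij : (i : ℕ) + 1 = j) (k : Fin N) :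
    ((Word.act (Equiv.swap i j) l).pre k : ℤ) =
      l.pre k + if k = i then ((l.1 j : ℕ) : ℤ) - (l.1 i : ℕ) else 0 := by
  rw [Word.pre_swap l (adj_lt hij)]
  congr 2
  simp only [Fin.le_def, Fin.lt_def, Fin.ext_iff, eq_iff_iff]
  omega

theorem Word.length_swap_adj (l : Word N n) {i j : Fin N} (hij : (i : ℕ) + 1 = j) :
    ((Word.act (Equiv.swap i j) l).length : ℤ) = l.length + ((l.1 j : ℕ) - (l.1 i : ℕ)) := by
  have h1 := l.sum_pre
  have h2 := (Word.act (Equiv.swap i j) l).sum_pre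
  simp only [Word.pre_swap_adj l hij, Finset.sum_add_distrib, Finset.sum_ite_eq',
    Finset.mem_univ, if_true] at h2
  linarith

theorem Word.pre_adj (l : Word N n) {i j : Fin N} (hij : (i : ℕ) + 1 = j) :
    l.pre j = l.pre i + (l.1 j : ℕ) := by
  unfold Word.pre
  rw [← Finset.Iio_insert, Finset.sum_insert (by simp), add_comm]
  congr 2
  ext k; simp only [Finset.mem_Iio, Finset.mem_Iic, Fin.le_def, Fin.lt_def]; omega

/-- Access to the prefix just before `i`; the empty prefix has no index in `Fin N`, hence the
separate case. -/
theorem Word.pre_eq_zero_or (l : Word N n) (i : Fin N) :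
    (l.pre i = l.1 i ∧ (i : ℕ) = 0) ∨
      ∃ h : Fin N, (h : ℕ) + 1 = i ∧ l.pre i = l.pre h + (l.1 i : ℕ) := by
  rcases Nat.eq_zero_or_pos (i : ℕ) with h | h
  · refine Or.inl ⟨?_, h⟩
    unfold Word.pre
    rw [Finset.sum_eq_single i]
    · intro k hk hki
      rw [Finset.mem_Iic, Fin.le_def] at hk
      exact absurd (Fin.ext (by omega)) hki
    · simp
  · have hi : ((⟨i - 1, by omega⟩ : Fin N) : ℕ) + 1 = i := by simp; omega
    exact Or.inr ⟨⟨i - 1, by omega⟩, hi, l.pre_adj hi⟩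

theorem Word.exists_adj_of_lt (r : Fin 2 → Fin 2 → Prop) [Std.Refl r] [IsTrans (Fin 2) r]
    (l : Word N n) (h : ∀ i j : Fin N, (i : ℕ) + 1 = j → r (l.1 i) (l.1 j)) {a b : Fin N}
    (hab : a ≤ b) : r (l.1 a) (l.1 b) := by
  have key : ∀ k, (a : ℕ) ≤ k → ∀ hk : k < N, r (l.1 a) (l.1 ⟨k, hk⟩) := fun k hk => by
    induction k, hk using Nat.le_induction with
    | base => exact fun _ => refl _
    | succ k _ ih =>
      exact fun hk => _root_.trans (ih (by omega)) (h ⟨k, by omega⟩ ⟨k + 1, hk⟩ rfl)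
  exact key b hab b.isLt

/-- A word without adjacent descents has length zero. -/
theorem Word.exists_descent {l : Word N n} (h : l.length ≠ 0) :
    ∃ i j : Fin N, (i : ℕ) + 1 = j ∧ l.1 j < l.1 i := by
  by_contra! hc
  apply h
  unfold Word.length
  rw [Finset.card_eq_zero, Finset.filter_eq_empty_iff]
  rintro p - ⟨h1, h2⟩
  exact absurd (Word.exists_adj_of_lt (· ≤ ·) l hc h1.le) (not_le.2 h2)

theorem Word.antitone_or_exists_ascent (l : Word N n) :
    (∀ a b : Fin N, a ≤ b → l.1 b ≤ l.1 a) ∨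
      ∃ i j : Fin N, (i : ℕ) + 1 = j ∧ l.1 i < l.1 j := by
  by_contra! hc
  obtain ⟨⟨a, b, hab, h1⟩, h2⟩ := hc
  exact absurd (Word.exists_adj_of_lt (· ≥ ·) l h2 hab) (not_le.2 h1)

theorem Word.swap_swap (i j : Fin N) (l : Word N n) :
    Word.act (Equiv.swap i j) (Word.act (Equiv.swap i j) l) = l := by
  rw [Word.act_act, Equiv.swap_mul_self, Word.act_one]

theorem Word.swap_eq_self {i j : Fin N} {l : Word N n} (h : l.1 i = l.1 j) :
    Word.act (Equiv.swap i j) l = l := by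
  apply Subtype.ext; funext k
  rw [Word.act_apply, Equiv.swap_inv]
  rcases eq_or_ne k i with rfl | hi
  · rw [Equiv.swap_apply_left, h]
  rcases eq_or_ne k j with rfl | hj
  · rw [Equiv.swap_apply_right, h]
  rw [Equiv.swap_apply_of_ne_of_ne hi hj]

theorem Word.swap_left (i j : Fin N) (l : Word N n) :
    (Word.act (Equiv.swap i j) l).1 i = l.1 j := by
  rw [Word.act_apply, Equiv.swap_inv, Equiv.swap_apply_left]

theorem Word.swap_right (i j : Fin N) (l : Word N n) :
    (Word.act (Equiv.swap i j) l).1 j = l.1 i := by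
  rw [Word.act_apply, Equiv.swap_inv, Equiv.swap_apply_right]

/-! ### Lifting properties of the order under adjacent transpositions -/

section Order

variable {i j : Fin N} {l m : Word N n}

theorem Word.GE.swap_of_ge (hij : (i : ℕ) + 1 = j) (h : Word.GE m l) (hl : l.1 j ≤ l.1 i) :
    Word.GE m (Word.act (Equiv.swap i j) l) := fun k => by
  have h1 := l.pre_swap_adj hij k
  have h2 := h k
  change l.pre k ≤ m.pre k at h2
  change Word.pre _ k ≤ m.pre k
  have hl' : ((l.1 j : ℕ) : ℤ) ≤ (l.1 i : ℕ) := by exact_mod_cast hl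
  split_ifs at h1 <;> omega

theorem Word.GE.swap_swap_of_gt (hij : (i : ℕ) + 1 = j)
    (h : Word.GE (Word.act (Equiv.swap i j) m) l) (hl : l.1 j < l.1 i) :
    Word.GE m (Word.act (Equiv.swap i j) l) := fun k => by
  have h1 := l.pre_swap_adj hij k
  have h3 := m.pre_swap_adj hij k
  have h2 := h k
  change l.pre k ≤ Word.pre _ k at h2
  change Word.pre _ k ≤ m.pre k
  have hl' : ((l.1 j : ℕ) : ℤ) < (l.1 i : ℕ) := by exact_mod_cast hl
  have := (m.1 i).isLt
  have := (m.1 j).isLt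
  split_ifs at h1 h3 <;> omega

/-- Only the prefix sum at `i` changes under the swap. If both letters of `l` are `0`, the bound
there follows from the prefix before `i`; if both are `1`, it follows from the prefix at `j`. -/
theorem Word.GE.of_swap_of_eq (hij : (i : ℕ) + 1 = j)
    (h : Word.GE (Word.act (Equiv.swap i j) m) l) (hl : l.1 i = l.1 j) : Word.GE m l := fun k => by
  have h3 := m.pre_swap_adj hij k
  have h2 := h k
  change l.pre k ≤ Word.pre _ k at h2
  change l.pre k ≤ m.pre k
  split_ifs at h3 with hk
  · subst hk
    have h4 := h j
    change l.pre j ≤ Word.pre _ j at h4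
    have h5 := m.pre_swap_adj hij j
    rw [if_neg (adj_lt hij).ne'] at h5
    have h6 := l.pre_adj hij
    have h7 := m.pre_adj hij
    have hl' : ((l.1 k : ℕ) : ℤ) = (l.1 j : ℕ) := by exact_mod_cast congrArg Fin.val hl
    have := (m.1 k).isLt
    have := (m.1 j).isLt
    rcases l.pre_eq_zero_or k with ⟨h8, h9⟩ | ⟨x, hx, h8⟩
    · rcases m.pre_eq_zero_or k with ⟨h10, -⟩ | ⟨x, hx, h10⟩ <;> omega
    · rcases m.pre_eq_zero_or k with ⟨h10, h9⟩ | ⟨y, hy, h10⟩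
      · omega
      · obtain rfl : x = y := Fin.ext (by omega)
        have h11 := h x
        change l.pre x ≤ Word.pre _ x at h11
        have h12 := m.pre_swap_adj hij x
        rw [if_neg (by rintro rfl; omega)] at h12
        omega
  · omega

theorem Word.GE.swap_of_descent (hij : (i : ℕ) + 1 = j) (h : Word.GE m l) (hl : l.1 i ≤ l.1 j)
    (hm : m.1 j < m.1 i) :
    Word.GE (Word.act (Equiv.swap i j) m) l := by
  rcases hl.lt_or_eq with hl | hl
  · intro k
    have h3 := m.pre_swap_adj hij k
    have h2 := h k
    change l.pre k ≤ m.pre k at h2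
    change l.pre k ≤ Word.pre _ k
    split_ifs at h3 with hk
    · subst hk
      have h4 := h j
      change l.pre j ≤ m.pre j at h4
      have h6 := l.pre_adj hij
      have h7 := m.pre_adj hij
      have hl' : ((l.1 k : ℕ) : ℤ) < (l.1 j : ℕ) := by exact_mod_cast hl
      have hm' : ((m.1 j : ℕ) : ℤ) < (m.1 k : ℕ) := by exact_mod_cast hm
      have := (m.1 k).isLt
      have := (l.1 j).isLt
      omega
    · omega
  · exact Word.GE.of_swap_of_eq hij (by rwa [Word.swap_swap]) hl

theorem Word.GE.swap_swap_of_descent (hij : (i : ℕ) + 1 = j) (h : Word.GE m l)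
    (hl : l.1 j < l.1 i) :
    Word.GE (Word.act (Equiv.swap i j) m) (Word.act (Equiv.swap i j) l) :=
  Word.GE.swap_swap_of_gt hij (by rwa [Word.swap_swap]) hl

end Order

/-! ### Divisibility by differences of variables -/

open MvPolynomial in
/-- The substitution `t_a := t_b`. -/
noncomputable def identify (a b : Fin N) : P N →ₐ[ℂ] P N :=
  aeval fun c => if c = a then X b else X c

theorem identify_X (a b c : Fin N) :
    identify a b (MvPolynomial.X c) = MvPolynomial.X (if c = a then b else c) := by
  rw [identify, MvPolynomial.aeval_X]; split_ifs <;> rfl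

theorem identify_swap (a b : Fin N) (f : P N) :
    identify a b (MvPolynomial.rename (Equiv.swap a b) f) = identify a b f := by
  rw [← AlgHom.comp_apply]
  congr 1
  refine MvPolynomial.algHom_ext fun c => ?_
  rw [AlgHom.comp_apply, MvPolynomial.rename_X, identify_X, identify_X]
  congr 1
  rcases eq_or_ne c a with rfl | hca
  · simp
  rcases eq_or_ne c b with rfl | hcb
  · simp [hca]
  · rw [Equiv.swap_apply_of_ne_of_ne hca hcb]

theorem dvd_sub_identify (a b : Fin N) (f : P N) :
    (MvPolynomial.X a - MvPolynomial.X b : P N) ∣ f - identify a b f := by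
  induction f using MvPolynomial.induction_on with
  | C c => simp [identify]
  | add p q hp hq =>
    rw [map_add, add_sub_add_comm]; exact dvd_add hp hq
  | mul_X p c hp =>
    rw [map_mul, identify_X]
    have : p * MvPolynomial.X c - identify a b p * MvPolynomial.X (if c = a then b else c)
        = (p - identify a b p) * MvPolynomial.X c
          + identify a b p * (MvPolynomial.X c - MvPolynomial.X (if c = a then b else c)) := by
      ring
    rw [this]
    refine dvd_add (hp.mul_right _) (Dvd.dvd.mul_left ?_ _)
    split_ifs with h
    · rw [h]
    · simp

/-- Divisibility becomes membership in the kernel of a ring homomorphism to a domain, which yields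
primality of `t_a - t_b`. -/
theorem dvd_iff_identify_eq_zero (a b : Fin N) (f : P N) :
    (MvPolynomial.X a - MvPolynomial.X b : P N) ∣ f ↔ identify a b f = 0 := by
  constructor
  · rintro ⟨g, rfl⟩
    rw [map_mul, map_sub, identify_X, identify_X]
    split_ifs <;> simp_all
  · intro h
    have := dvd_sub_identify a b f
    rwa [h, sub_zero] at this

theorem X_sub_X_ne_zero {a b : Fin N} (h : a ≠ b) :
    (MvPolynomial.X a - MvPolynomial.X b : P N) ≠ 0 :=
  sub_ne_zero.2 fun h' => h (MvPolynomial.X_injective h')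

theorem totalDegree_X_sub_X {a b : Fin N} (h : a ≠ b) :
    (MvPolynomial.X a - MvPolynomial.X b : P N).totalDegree = 1 :=
  ((MvPolynomial.isHomogeneous_X ℂ a).sub (MvPolynomial.isHomogeneous_X ℂ b)).totalDegree
    (X_sub_X_ne_zero h)

theorem prime_X_sub_X {a b : Fin N} (h : a ≠ b) :
    Prime (MvPolynomial.X a - MvPolynomial.X b : P N) := by
  refine ⟨X_sub_X_ne_zero h, fun hu => ?_, fun f g hfg => ?_⟩
  · have := (dvd_iff_identify_eq_zero a b 1).1 hu.dvd
    simp at this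
  · simp only [dvd_iff_identify_eq_zero, map_mul] at hfg ⊢
    exact mul_eq_zero.1 hfg

theorem X_sub_X_not_dvd {a b c d : Fin N} (hcd : c ≠ d) (h1 : ¬(a = c ∧ b = d))
    (h2 : ¬(a = d ∧ b = c)) :
    ¬(MvPolynomial.X a - MvPolynomial.X b : P N) ∣ MvPolynomial.X c - MvPolynomial.X d := by
  rw [dvd_iff_identify_eq_zero, map_sub, identify_X, identify_X, sub_eq_zero]
  intro h
  have := MvPolynomial.X_injective h
  split_ifs at this <;> simp_all

theorem dvd_sub_rename_swap (a b : Fin N) (f : P N) :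
    (MvPolynomial.X a - MvPolynomial.X b : P N) ∣
      f - MvPolynomial.rename (Equiv.swap a b) f := by
  rw [dvd_iff_identify_eq_zero, map_sub, identify_swap, sub_self]

/-- The product of the weights of the inversions of `λ`. -/
noncomputable def invProd (w : Equiv.Perm (Fin N)) (l : Word N n) : P N :=
  ∏ p ∈ Word.inv w l, (MvPolynomial.X p.1 - MvPolynomial.X p.2)

theorem Word.mem_inv {w : Equiv.Perm (Fin N)} {l : Word N n} {p : Fin N × Fin N} :
    p ∈ Word.inv w l ↔ w⁻¹ p.1 < w⁻¹ p.2 ∧ l.1 p.2 < l.1 p.1 := by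
  simp [Word.inv]

theorem Word.mem_inv_one {l : Word N n} {p : Fin N × Fin N} :
    p ∈ Word.inv 1 l ↔ p.1 < p.2 ∧ l.1 p.2 < l.1 p.1 := by
  simp [Word.mem_inv]

theorem Word.card_inv_one (l : Word N n) : (Word.inv 1 l).card = l.length := by
  simp [Word.inv, Word.length]

theorem invProd_ne_zero (w : Equiv.Perm (Fin N)) (l : Word N n) : invProd w l ≠ 0 := by
  refine Finset.prod_ne_zero_iff.2 fun p hp => X_sub_X_ne_zero fun h => ?_
  have := (Word.mem_inv.1 hp).1
  rw [h] at this
  exact lt_irrefl _ this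

theorem isHomogeneous_invProd (l : Word N n) : (invProd 1 l).IsHomogeneous l.length := by
  rw [← Word.card_inv_one, Finset.card_eq_sum_ones]
  exact MvPolynomial.IsHomogeneous.prod _ _ _ fun p _ =>
    (MvPolynomial.isHomogeneous_X ℂ p.1).sub (MvPolynomial.isHomogeneous_X ℂ p.2)

theorem totalDegree_invProd (l : Word N n) : (invProd 1 l).totalDegree = l.length :=
  (isHomogeneous_invProd l).totalDegree (invProd_ne_zero 1 l)

/-- The weights of distinct inversions are non-associated primes: the condition `p.1 < p.2` rules
out a pair together with its reverse. -/
theorem invProd_dvd {l : Word N n} {f : P N}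
    (h : ∀ p ∈ Word.inv 1 l, (MvPolynomial.X p.1 - MvPolynomial.X p.2 : P N) ∣ f) :
    invProd 1 l ∣ f := by
  refine Finset.prod_dvd_of_isRelPrime (fun p hp q hq hpq => ?_) h
  have hp := (Word.mem_inv_one.1 hp).1
  have hq := (Word.mem_inv_one.1 hq).1
  refine (prime_X_sub_X hp.ne).irreducible.isRelPrime_iff_not_dvd.2
    (X_sub_X_not_dvd hq.ne (fun h => hpq (Prod.ext h.1 h.2)) fun h => ?_)
  rw [h.1, h.2] at hp
  exact lt_asymm hp hq

/-! ### Classes -/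

theorem HT.dvd {α : Word N n → P N} (hα : α ∈ HT N n) {i j : Fin N} (hij : i ≠ j)
    (l : Word N n) : (MvPolynomial.X i - MvPolynomial.X j : P N) ∣
      α l - α (Word.act (Equiv.swap i j) l) := hα i j hij l

/-- A class that vanishes at all words shorter than `l` is divisible at `l` by the weights of the
inversions of `l`. -/
theorem HT.invProd_dvd {α : Word N n → P N} (hα : α ∈ HT N n) {l : Word N n}
    (h : ∀ m : Word N n, m.length < l.length → α m = 0) : invProd 1 l ∣ α l := by
  refine WallCrossing.invProd_dvd fun p hp => ?_
  obtain ⟨h1, h2⟩ := Word.mem_inv_one.1 hp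
  have := HT.dvd hα h1.ne l
  rwa [h _ (l.length_swap_lt h1 h2), sub_zero] at this

/-- A class of small degree on its support vanishes. -/
theorem HT.eq_zero_of_totalDegree_lt {α : Word N n → P N} (hα : α ∈ HT N n)
    (h : ∀ m, α m ≠ 0 → (α m).totalDegree < m.length) : α = 0 := by
  have key : ∀ k : ℕ, ∀ m : Word N n, m.length = k → α m = 0 := fun k => by
    induction k using Nat.strong_induction_on with
    | _ k ih =>
      intro m hm
      by_contra hne
      obtain ⟨g, hg⟩ := HT.invProd_dvd hα (l := m) fun m' hm' => ih _ (hm ▸ hm') m' rfl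
      have hg0 : g ≠ 0 := fun h0 => hne (by rw [hg, h0, mul_zero])
      have := h m hne
      rw [hg, MvPolynomial.totalDegree_mul_of_isDomain (invProd_ne_zero 1 m) hg0,
        totalDegree_invProd] at this
      omega
  funext m
  exact key _ m rfl

/-! ### The action of the symmetric group on classes -/

theorem apply_inv_cancel (w : Equiv.Perm (Fin N)) (i : Fin N) : w (w⁻¹ i) = i :=
  w.apply_symm_apply i

/-- The action of a permutation on functions `Λ_n → P`, through both the words and the
variables. -/
noncomputable def twist (w : Equiv.Perm (Fin N)) (α : Word N n → P N) : Word N n → P N :=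
  fun m => MvPolynomial.rename w (α (Word.act w⁻¹ m))

theorem twist_apply (w : Equiv.Perm (Fin N)) (α : Word N n → P N) (m : Word N n) :
    twist w α m = MvPolynomial.rename w (α (Word.act w⁻¹ m)) := rfl

theorem twist_twist (w v : Equiv.Perm (Fin N)) (α : Word N n → P N) :
    twist w (twist v α) = twist (w * v) α := by
  funext m
  rw [twist_apply, twist_apply, twist_apply, MvPolynomial.rename_rename, Word.act_act, mul_inv_rev]
  rfl

theorem twist_one (α : Word N n → P N) : twist 1 α = α := by
  funext m
  rw [twist_apply, inv_one, Word.act_one, Equiv.Perm.coe_one, MvPolynomial.rename_id_apply]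

theorem twist_swap_twist_swap (i j : Fin N) (α : Word N n → P N) :
    twist (Equiv.swap i j) (twist (Equiv.swap i j) α) = α := by
  rw [twist_twist, Equiv.swap_mul_self, twist_one]

theorem twist_swap_apply (i j : Fin N) (α : Word N n → P N) (m : Word N n) :
    twist (Equiv.swap i j) α m =
      MvPolynomial.rename (Equiv.swap i j) (α (Word.act (Equiv.swap i j) m)) := by
  rw [twist_apply, Equiv.swap_inv]

theorem twist_mem (w : Equiv.Perm (Fin N)) {α : Word N n → P N} (hα : α ∈ HT N n) :
    twist w α ∈ HT N n := fun i j hij l => by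
  have hd := HT.dvd hα (w⁻¹.injective.ne hij) (Word.act w⁻¹ l)
  have := map_dvd (MvPolynomial.rename w) hd
  rw [map_sub, map_sub, MvPolynomial.rename_X, MvPolynomial.rename_X, apply_inv_cancel,
    apply_inv_cancel, Word.act_act] at this
  rw [twist_apply, twist_apply, Word.act_act]
  have e : Equiv.swap (w⁻¹ i) (w⁻¹ j) * w⁻¹ = w⁻¹ * Equiv.swap i j := by
    rw [Equiv.mul_swap_eq_swap_mul]
  rwa [e] at this

/-- Divided differences of classes exist and are classes. -/
theorem HT.exists_divided_difference {α : Word N n → P N} (hα : α ∈ HT N n) {i j : Fin N}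
    (hij : i ≠ j) : ∃ β ∈ HT N n, ∀ m,
      (MvPolynomial.X i - MvPolynomial.X j) * β m = α m - twist (Equiv.swap i j) α m := by
  have hdiv : ∀ m, (MvPolynomial.X i - MvPolynomial.X j : P N) ∣
      α m - twist (Equiv.swap i j) α m := fun m => by
    have h1 := HT.dvd hα hij m
    have h2 := dvd_sub_rename_swap i j (α (Word.act (Equiv.swap i j) m))
    have := dvd_add h1 h2
    rwa [sub_add_sub_cancel, ← twist_swap_apply] at this
  choose β hβ using hdiv
  refine ⟨β, fun a b hab l => ?_, fun m => (hβ m).symm⟩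
  have hne := X_sub_X_ne_zero hij
  by_cases hs : (a = i ∧ b = j) ∨ (a = j ∧ b = i)
  · have key : ∀ l, (MvPolynomial.X i - MvPolynomial.X j : P N) ∣
        β l - β (Word.act (Equiv.swap i j) l) := fun l => by
      obtain ⟨q, hq⟩ := HT.dvd hα hij l
      -- For the transposition `s = (i, j)` itself: the quotient `q` of `α l - α (s l)` is twisted
      -- with a sign, as `s` negates `t_i - t_j`.
      have e : β l - β (Word.act (Equiv.swap i j) l)
          = q - MvPolynomial.rename (Equiv.swap i j) q := by
        have h1 := hβ l
        have h2 := hβ (Word.act (Equiv.swap i j) l)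
        rw [twist_swap_apply] at h1 h2
        rw [Word.swap_swap] at h2
        have h3 := congrArg (MvPolynomial.rename (Equiv.swap i j)) hq
        rw [map_sub, map_mul, map_sub, MvPolynomial.rename_X, MvPolynomial.rename_X,
          Equiv.swap_apply_left, Equiv.swap_apply_right] at h3
        apply mul_left_cancel₀ hne
        linear_combination -h1 + h2 + hq + h3
      rw [e]
      exact dvd_sub_rename_swap i j q
    rcases hs with ⟨rfl, rfl⟩ | ⟨rfl, rfl⟩
    · exact key l
    · rw [Equiv.swap_comm, ← neg_sub, neg_dvd]; exact key l
  -- For any other transposition, `t_a - t_b` is a prime not dividing `t_i - t_j`, so that factor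
  -- can be cancelled.
  · have h1 : (MvPolynomial.X a - MvPolynomial.X b : P N) ∣
        (MvPolynomial.X i - MvPolynomial.X j) * (β l - β (Word.act (Equiv.swap a b) l)) := by
      have e : (MvPolynomial.X i - MvPolynomial.X j) * (β l - β (Word.act (Equiv.swap a b) l))
          = (α l - α (Word.act (Equiv.swap a b) l)) - (twist (Equiv.swap i j) α l
            - twist (Equiv.swap i j) α (Word.act (Equiv.swap a b) l)) := by
        linear_combination -hβ l + hβ (Word.act (Equiv.swap a b) l)
      rw [e]
      exact dvd_sub (HT.dvd hα hab l) (HT.dvd (twist_mem _ hα) hab l)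
    exact ((prime_X_sub_X hab).dvd_or_dvd h1).resolve_left
      (X_sub_X_not_dvd hij (fun h => hs (Or.inl h)) fun h => hs (Or.inr h))

/-! ### Untwisted Schubert classes -/

/-- A class supported above `l`, with the prescribed value at `l`, and of degree at most `ℓ(l)`. -/
structure IsSchubert (l : Word N n) (α : Word N n → P N) : Prop where
  mem : α ∈ HT N n
  support : ∀ m, α m ≠ 0 → Word.GE m l
  value : α l = invProd 1 l
  degree : ∀ m, (α m).totalDegree ≤ l.length

theorem IsSchubert.eq_zero_of_length_le {l m : Word N n} {α : Word N n → P N}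
    (h : IsSchubert l α) (hm : m.length ≤ l.length) (hne : m ≠ l) : α m = 0 := by
  by_contra h0
  exact hne ((h.support m h0).eq_of_length_le hm)

/-- The difference lives on words longer than `l` but has degree at most `ℓ(l)`. -/
theorem IsSchubert.unique {l : Word N n} {α β : Word N n → P N} (hα : IsSchubert l α)
    (hβ : IsSchubert l β) : α = β := by
  rw [← sub_eq_zero]
  refine HT.eq_zero_of_totalDegree_lt (sub_mem hα.mem hβ.mem) fun m hm => ?_
  rw [Pi.sub_apply] at hm ⊢
  have hlt : l.length < m.length := by
    by_contra! hle
    rcases eq_or_ne m l with rfl | hne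
    · exact hm (by rw [hα.value, hβ.value, sub_self])
    · exact hm (by rw [hα.eq_zero_of_length_le hle hne, hβ.eq_zero_of_length_le hle hne, sub_self])
  exact ((MvPolynomial.totalDegree_sub _ _).trans (max_le (hα.degree m) (hβ.degree m))).trans_lt hlt

theorem dvd_invProd {l : Word N n} (hl : ∀ a b : Fin N, a ≤ b → l.1 b ≤ l.1 a) {i j : Fin N}
    (h : l.1 i ≠ l.1 j) : (MvPolynomial.X i - MvPolynomial.X j : P N) ∣ invProd 1 l := by
  rcases le_total i j with hij | hij
  · exact Finset.dvd_prod_of_mem (fun p : Fin N × Fin N =>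
      (MvPolynomial.X p.1 - MvPolynomial.X p.2 : P N)) (a := (i, j))
      (Word.mem_inv_one.2 ⟨hij.lt_of_ne (by rintro rfl; exact h rfl), (hl i j hij).lt_of_ne h.symm⟩)
  · rw [← neg_sub, neg_dvd]
    exact Finset.dvd_prod_of_mem (fun p : Fin N × Fin N =>
      (MvPolynomial.X p.1 - MvPolynomial.X p.2 : P N)) (a := (j, i))
      (Word.mem_inv_one.2 ⟨hij.lt_of_ne (by rintro rfl; exact h rfl), (hl j i hij).lt_of_ne h⟩)

-- Start of the construction. A transposition moves `l` only if it exchanges different letters, and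
-- its weight is then, up to sign, a factor of `invProd 1 l`.
open Classical in
theorem isSchubert_of_antitone {l : Word N n} (hl : ∀ a b : Fin N, a ≤ b → l.1 b ≤ l.1 a) :
    IsSchubert l (fun m => if m = l then invProd 1 l else 0) where
  mem i j hij m := by
    by_cases h : m.1 i = m.1 j
    · rw [Word.swap_eq_self h, sub_self]; exact dvd_zero _
    · refine dvd_sub ?_ ?_
      all_goals dsimp only
      · split_ifs with hm
        · subst hm; exact dvd_invProd hl h
        · exact dvd_zero _
      · split_ifs with hm
        · refine dvd_invProd hl ?_
          rw [← hm, Word.swap_left, Word.swap_right]; exact fun h' => h h'.symm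
        · exact dvd_zero _
  support m hm := by
    split_ifs at hm with h
    · rw [h]; exact Word.GE.refl l
    · exact absurd rfl hm
  value := if_pos rfl
  degree m := by
    split_ifs
    · exact (totalDegree_invProd l).le
    · simp

theorem swap_adj_lt_iff {i j : Fin N} (hij : (i : ℕ) + 1 = j) {a b : Fin N}
    (h : ¬(a = j ∧ b = i)) :
    Equiv.swap i j a < Equiv.swap i j b ↔ a < b ∧ ¬(a = i ∧ b = j) := by
  simp only [Equiv.swap_apply_def]
  simp only [Fin.ext_iff, Fin.lt_def] at *
  split_ifs <;> omega

/-- An adjacent transposition matches the inversions of `l` other than `(i, j)` with those of the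
swapped word; the factor of `(i, j)` becomes `t_j - t_i`. -/
theorem invProd_swap_adj {i j : Fin N} (hij : (i : ℕ) + 1 = j) {l : Word N n}
    (hl : l.1 j < l.1 i) :
    (MvPolynomial.X j - MvPolynomial.X i) * invProd 1 (Word.act (Equiv.swap i j) l) =
      MvPolynomial.rename (Equiv.swap i j) (invProd 1 l) := by
  have hmem : (i, j) ∈ Word.inv 1 l := Word.mem_inv_one.2 ⟨adj_lt hij, hl⟩
  unfold invProd
  rw [← Finset.mul_prod_erase _ _ hmem, map_mul, map_sub, MvPolynomial.rename_X,
    MvPolynomial.rename_X, Equiv.swap_apply_left, Equiv.swap_apply_right, map_prod]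
  congr 1
  symm
  refine Finset.prod_equiv ((Equiv.swap i j).prodCongr (Equiv.swap i j)) (fun p => ?_)
    fun p _ => ?_
  · rw [Finset.mem_erase, Word.mem_inv_one, Word.mem_inv_one]
    simp only [Equiv.prodCongr_apply, Prod.map_fst, Prod.map_snd, Word.act_apply, Equiv.swap_inv,
      Equiv.swap_apply_self, ne_eq, Prod.ext_iff]
    constructor
    · rintro ⟨h1, h2, h3⟩
      refine ⟨(swap_adj_lt_iff hij ?_).2 ⟨h2, h1⟩, h3⟩
      rintro ⟨h4, h5⟩
      rw [h4, h5] at h3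
      exact lt_asymm hl h3
    · rintro ⟨h1, h3⟩
      rw [swap_adj_lt_iff hij] at h1
      · exact ⟨h1.2, h1.1, h3⟩
      rintro ⟨h4, h5⟩
      rw [h4, h5] at h3
      exact lt_asymm hl h3
  · rw [map_sub, MvPolynomial.rename_X, MvPolynomial.rename_X]; rfl

theorem totalDegree_twist_swap_le {l : Word N n} {α : Word N n → P N} (h : IsSchubert l α)
    (i j : Fin N) (m : Word N n) : (twist (Equiv.swap i j) α m).totalDegree ≤ l.length := by
  rw [twist_swap_apply]
  exact (MvPolynomial.totalDegree_rename_le _ _).trans (h.degree _)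

/-- Divided differences lower the degree. -/
theorem IsSchubert.totalDegree_divided_difference {l : Word N n} {α β : Word N n → P N}
    (h : IsSchubert l α) {i j : Fin N} (hij : i ≠ j)
    (hβ : ∀ m, (MvPolynomial.X i - MvPolynomial.X j) * β m =
      α m - twist (Equiv.swap i j) α m) {m : Word N n} (hm : β m ≠ 0) :
    (β m).totalDegree + 1 ≤ l.length := by
  have h1 := MvPolynomial.totalDegree_mul_of_isDomain (X_sub_X_ne_zero hij) hm
  rw [totalDegree_X_sub_X hij, hβ m] at h1
  have h2 := (MvPolynomial.totalDegree_sub (α m) (twist (Equiv.swap i j) α m)).trans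
    (max_le (h.degree m) (totalDegree_twist_swap_le h i j m))
  omega

theorem support_divided_difference {α β : Word N n → P N} {i j : Fin N}
    (hβ : ∀ m, (MvPolynomial.X i - MvPolynomial.X j) * β m =
      α m - twist (Equiv.swap i j) α m) {m : Word N n} (hm : β m ≠ 0) (hij : i ≠ j) :
    α m ≠ 0 ∨ α (Word.act (Equiv.swap i j) m) ≠ 0 := by
  by_contra! h0
  have := hβ m
  rw [twist_swap_apply, h0.1, h0.2, map_zero, sub_zero, mul_eq_zero] at this
  exact this.elim (X_sub_X_ne_zero hij) hm

theorem IsSchubert.divided_difference {l : Word N n} {α β : Word N n → P N} (h : IsSchubert l α)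
    {i j : Fin N} (hij : (i : ℕ) + 1 = j) (hl : l.1 j < l.1 i) (hmem : β ∈ HT N n)
    (hβ : ∀ m, (MvPolynomial.X i - MvPolynomial.X j) * β m =
      α m - twist (Equiv.swap i j) α m) : IsSchubert (Word.act (Equiv.swap i j) l) β := by
  have hne := (adj_lt hij).ne
  have hlen := l.length_swap_adj hij
  have hl' : (l.1 j : ℕ) < l.1 i := hl
  have := (l.1 i).isLt
  refine ⟨hmem, fun m hm => ?_, ?_, fun m => ?_⟩
  · rcases support_divided_difference hβ hm hne with h0 | h0
    · exact (h.support m h0).swap_of_ge hij hl.le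
    · exact (h.support _ h0).swap_swap_of_gt hij hl
  · apply mul_left_cancel₀ (X_sub_X_ne_zero hne)
    -- At the swapped, shorter word `α` vanishes, so only the twisted term survives.
    have hlt := l.length_swap_lt (adj_lt hij) hl
    rw [hβ, h.eq_zero_of_length_le hlt.le (fun e => by rw [e] at hlt; exact lt_irrefl _ hlt),
      twist_swap_apply, Word.swap_swap, h.value, ← invProd_swap_adj hij hl]
    ring
  · rcases eq_or_ne (β m) 0 with h0 | h0
    · simp [h0]
    · have := h.totalDegree_divided_difference hne hβ h0
      omega

theorem exists_isSchubert (l : Word N n) : ∃ α, IsSchubert l α := by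
  -- The cardinality is only a crude upper bound for lengths, which makes induction on the colength
  -- possible.
  have key : ∀ k : ℕ, ∀ l : Word N n, Fintype.card (Fin N × Fin N) - l.length = k →
      ∃ α, IsSchubert l α := fun k => by
    induction k using Nat.strong_induction_on with
    | _ k ih =>
      intro l hk
      rcases l.antitone_or_exists_ascent with h | ⟨i, j, hij, h⟩
      · exact ⟨_, isSchubert_of_antitone h⟩
      · have hlt : l.length < (Word.act (Equiv.swap i j) l).length := by
          have h1 := l.length_swap_adj hij
          have h2 : (l.1 i : ℕ) < l.1 j := h
          omega
        have hle : (Word.act (Equiv.swap i j) l).length ≤ Fintype.card (Fin N × Fin N) :=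
          Finset.card_le_univ _
        obtain ⟨α, hα⟩ := ih _ (by omega) (Word.act (Equiv.swap i j) l) rfl
        obtain ⟨β, hmem, hβ⟩ := HT.exists_divided_difference hα.mem (adj_lt hij).ne
        refine ⟨β, ?_⟩
        have := hα.divided_difference hij (by rwa [Word.swap_left, Word.swap_right]) hmem hβ
        rwa [Word.swap_swap] at this
  exact key _ l rfl

/-- The untwisted Schubert class of `l`. -/
noncomputable def schubert (l : Word N n) : Word N n → P N := (exists_isSchubert l).choose

theorem isSchubert_schubert (l : Word N n) : IsSchubert l (schubert l) :=
  (exists_isSchubert l).choose_spec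

/-- Wall-crossing for untwisted Schubert classes at a descent. -/
theorem schubert_sub_twist_of_gt {i j : Fin N} (hij : (i : ℕ) + 1 = j) {l : Word N n}
    (hl : l.1 j < l.1 i) (m : Word N n) :
    (MvPolynomial.X i - MvPolynomial.X j) * schubert (Word.act (Equiv.swap i j) l) m =
      schubert l m - twist (Equiv.swap i j) (schubert l) m := by
  have h := isSchubert_schubert l
  obtain ⟨β, hmem, hβ⟩ := HT.exists_divided_difference h.mem (adj_lt hij).ne
  rw [(isSchubert_schubert _).unique (h.divided_difference hij hl hmem hβ), hβ]

/-- The divided difference is still supported above `l`, but its degree drops below `ℓ(l)`, so it is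
zero. -/
theorem twist_schubert_of_eq {i j : Fin N} (hij : (i : ℕ) + 1 = j) {l : Word N n}
    (hl : l.1 i = l.1 j) : twist (Equiv.swap i j) (schubert l) = schubert l := by
  have h := isSchubert_schubert l
  have hne := (adj_lt hij).ne
  obtain ⟨β, hmem, hβ⟩ := HT.exists_divided_difference h.mem hne
  have h0 : β = 0 := HT.eq_zero_of_totalDegree_lt hmem fun m hm => by
    have h1 := h.totalDegree_divided_difference hne hβ hm
    have hge : Word.GE m l := by
      rcases support_divided_difference hβ hm hne with h0 | h0
      · exact h.support m h0
      · exact (h.support _ h0).of_swap_of_eq hij hl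
    have := hge.length_le
    omega
  funext m
  have := hβ m
  rw [h0, Pi.zero_apply, mul_zero] at this
  exact (sub_eq_zero.1 this.symm).symm

/-- Here `schubert l` is the divided difference of the class of the swapped word: numerator and
denominator both change sign under the transposition. -/
theorem twist_schubert_of_lt {i j : Fin N} (hij : (i : ℕ) + 1 = j) {l : Word N n}
    (hl : l.1 i < l.1 j) : twist (Equiv.swap i j) (schubert l) = schubert l := by
  have h := schubert_sub_twist_of_gt hij (l := Word.act (Equiv.swap i j) l)
    (by rwa [Word.swap_left, Word.swap_right])
  rw [Word.swap_swap] at h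
  funext m
  apply mul_left_cancel₀ (X_sub_X_ne_zero (adj_lt hij).ne')
  have h1 := h m
  have h2 := congrArg (MvPolynomial.rename (Equiv.swap i j)) (h (Word.act (Equiv.swap i j) m))
  rw [map_mul, map_sub, map_sub, MvPolynomial.rename_X, MvPolynomial.rename_X,
    Equiv.swap_apply_left, Equiv.swap_apply_right, ← twist_swap_apply, ← twist_swap_apply,
    ← twist_swap_apply, twist_swap_twist_swap] at h2
  linear_combination h1 + h2

/-- Wall-crossing for untwisted Schubert classes. -/
theorem twist_schubert_swap {i j : Fin N} (hij : (i : ℕ) + 1 = j) (l m : Word N n) :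
    twist (Equiv.swap i j) (schubert (Word.act (Equiv.swap i j) l)) m =
      schubert (Word.act (Equiv.swap i j) l) m +
        if l.1 i < l.1 j then (MvPolynomial.X j - MvPolynomial.X i) * schubert l m else 0 := by
  split_ifs with h
  · have := schubert_sub_twist_of_gt hij (l := Word.act (Equiv.swap i j) l)
      (by rwa [Word.swap_left, Word.swap_right]) m
    rw [Word.swap_swap] at this
    linear_combination this
  · rw [add_zero]
    rcases (not_lt.1 h).lt_or_eq with h | h
    · rw [twist_schubert_of_lt hij (by rwa [Word.swap_left, Word.swap_right])]
    · rw [twist_schubert_of_eq hij (by rw [Word.swap_left, Word.swap_right, h])]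

/-! ### Localisation: homogeneity and positivity -/

/-- Recursion for the localisations of the Schubert classes. -/
theorem schubert_apply {i j : Fin N} (hij : (i : ℕ) + 1 = j) (l : Word N n) (m : Word N n) :
    schubert l m =
      MvPolynomial.rename (Equiv.swap i j) (schubert l (Word.act (Equiv.swap i j) m)) +
        if l.1 j < l.1 i then (MvPolynomial.X i - MvPolynomial.X j) *
          MvPolynomial.rename (Equiv.swap i j)
            (schubert (Word.act (Equiv.swap i j) l) (Word.act (Equiv.swap i j) m)) else 0 := by
  have h := twist_schubert_swap hij (Word.act (Equiv.swap i j) l) m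
  rw [Word.swap_swap, Word.swap_left, Word.swap_right] at h
  rw [← twist_swap_apply, ← twist_swap_apply, h]
  split_ifs with hl
  · rw [twist_schubert_of_lt hij (by rwa [Word.swap_left, Word.swap_right])]
    ring
  · rw [add_zero, add_zero]

theorem schubert_of_length_eq_zero (l : Word N n) {m : Word N n} (hm : m.length = 0) :
    (m = l ∧ schubert l m = 1) ∨ (¬Word.GE m l ∧ schubert l m = 0) := by
  have h := isSchubert_schubert l
  by_cases hge : Word.GE m l
  · obtain rfl := hge.eq_of_length_le (by omega)
    refine Or.inl ⟨rfl, ?_⟩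
    have he : Word.inv 1 m = ∅ := Finset.card_eq_zero.1 (by rw [Word.card_inv_one, hm])
    rw [h.value, invProd, he, Finset.prod_empty]
  · exact Or.inr ⟨hge, not_not.1 fun h0 => hge (h.support m h0)⟩

/-- A Schubert class is homogeneous, and its localisation at `m`, evaluated at the point with
coordinates `m`, counts something nonempty whenever `m ≥ l`. -/
theorem schubert_localisation (l m : Word N n) :
    (schubert l m).IsHomogeneous l.length ∧
      ∃ k : ℕ, MvPolynomial.eval (fun i => ((m.1 i : ℕ) : ℂ)) (schubert l m) = k ∧
        (Word.GE m l → 0 < k) := by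
  suffices key : ∀ d : ℕ, ∀ m l : Word N n, m.length = d →
      (schubert l m).IsHomogeneous l.length ∧
        ∃ k : ℕ, MvPolynomial.eval (fun i => ((m.1 i : ℕ) : ℂ)) (schubert l m) = k ∧
          (Word.GE m l → 0 < k) from key _ m l rfl
  intro d
  induction d using Nat.strong_induction_on with
  | _ d ih =>
    intro m l hd
    rcases eq_or_ne m.length 0 with h0 | h0
    · rcases schubert_of_length_eq_zero l h0 with ⟨rfl, h1⟩ | ⟨h1, h2⟩
      · rw [h1, h0]
        exact ⟨MvPolynomial.isHomogeneous_one _ _, 1, by simp, fun _ => one_pos⟩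
      · rw [h2]
        exact ⟨MvPolynomial.isHomogeneous_zero _ _ _, 0, by simp, fun h => absurd h h1⟩
    obtain ⟨i, j, hij, hm⟩ := Word.exists_descent h0
    have hlt := m.length_swap_lt (adj_lt hij) hm
    -- Renaming the variables moves the evaluation point from `m` to the shorter word, where the
    -- induction hypothesis applies.
    have hcomp : (fun a => ((m.1 a : ℕ) : ℂ)) ∘ Equiv.swap i j =
        fun a => (((Word.act (Equiv.swap i j) m).1 a : ℕ) : ℂ) := by
      funext a; simp [Word.act_apply]
    have hmi : m.1 i = 1 := by rcases m.letter_cases i with h | h <;> simp_all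
    have hmj : m.1 j = 0 := by rcases m.letter_cases j with h | h <;> simp_all
    obtain ⟨hom1, k1, hk1, hpos1⟩ := ih _ (hd ▸ hlt) (Word.act (Equiv.swap i j) m) l rfl
    obtain ⟨hom2, k2, hk2, hpos2⟩ := ih _ (hd ▸ hlt) (Word.act (Equiv.swap i j) m)
      (Word.act (Equiv.swap i j) l) rfl
    rw [schubert_apply hij l m]
    split_ifs with hl
    · have hlen := l.length_swap_adj hij
      have hl' : (l.1 j : ℕ) < l.1 i := hl
      have := (l.1 i).isLt
      constructor
      · refine hom1.rename_isHomogeneous.add ?_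
        have := ((MvPolynomial.isHomogeneous_X ℂ i).sub (MvPolynomial.isHomogeneous_X ℂ j)).mul
          (hom2.rename_isHomogeneous (f := Equiv.swap i j))
        rwa [show 1 + (Word.act (Equiv.swap i j) l).length = l.length by omega] at this
      · refine ⟨k1 + k2, ?_, fun h => ?_⟩
        -- At a descent of `m` the weight `t_i - t_j` evaluates to `1 - 0 = 1`, so no signs enter
        -- and the counts add.
        · rw [map_add, map_mul, MvPolynomial.eval_rename, MvPolynomial.eval_rename, hcomp, hk1, hk2,
            map_sub, MvPolynomial.eval_X, MvPolynomial.eval_X, hmi, hmj]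
          simp
        · have := hpos2 (h.swap_swap_of_descent hij hl)
          omega
    · rw [add_zero]
      refine ⟨hom1.rename_isHomogeneous, k1, ?_, fun h => ?_⟩
      · rw [MvPolynomial.eval_rename, hcomp, hk1]
      · exact hpos1 (h.swap_of_descent hij (not_lt.1 hl) hm)

theorem totalDegree_schubert {l m : Word N n} (h : Word.GE m l) :
    (schubert l m).totalDegree = l.length := by
  obtain ⟨hom, k, hk, hpos⟩ := schubert_localisation l m
  refine hom.totalDegree fun h0 => ?_
  rw [h0, map_zero] at hk
  have := hpos h
  rw [← Nat.cast_zero, Nat.cast_inj] at hk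
  omega

/-! ### Twisted Schubert classes -/

theorem rename_injective_perm (w : Equiv.Perm (Fin N)) :
    Function.Injective (MvPolynomial.rename w : P N → P N) :=
  MvPolynomial.rename_injective _ w.injective

theorem totalDegree_rename_perm (w : Equiv.Perm (Fin N)) (f : P N) :
    (MvPolynomial.rename w f).totalDegree = f.totalDegree :=
  MvPolynomial.totalDegree_renameEquiv w f

theorem rename_invProd (v u : Equiv.Perm (Fin N)) (l : Word N n) :
    MvPolynomial.rename v (invProd u l) = invProd (v * u) (Word.act v l) := by
  unfold invProd
  rw [map_prod]
  refine Finset.prod_equiv (v.prodCongr v) (fun p => ?_) fun p _ => ?_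
  · rw [Word.mem_inv, Word.mem_inv]
    simp [Word.act_apply]
  · rw [map_sub, MvPolynomial.rename_X, MvPolynomial.rename_X]; rfl

theorem Word.twistedGE_mul {v u : Equiv.Perm (Fin N)} {m l : Word N n} :
    Word.twistedGE (v * u) m (Word.act v l) ↔ Word.twistedGE u (Word.act v⁻¹ m) l := by
  unfold Word.twistedGE
  rw [Word.act_act, Word.act_act]
  simp [mul_assoc]

/-- Permutations carry twisted Schubert classes to twisted Schubert classes. -/
theorem IsTwistedSchubertClass.twist {u : Equiv.Perm (Fin N)} {l : Word N n}
    {α : Word N n → P N} (h : IsTwistedSchubertClass u l α) (v : Equiv.Perm (Fin N)) :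
    IsTwistedSchubertClass (v * u) (Word.act v l) (WallCrossing.twist v α) := by
  have hl : Word.act v⁻¹ (Word.act v l) = l := by rw [Word.act_act, inv_mul_cancel, Word.act_one]
  refine ⟨twist_mem v h.isClass, ⟨?_, fun m hm => ?_⟩, ?_, fun m hm => ?_⟩
  · rw [twist_apply, hl]
    exact (map_ne_zero_iff _ (rename_injective_perm v)).2 h.support.1
  · rw [twist_apply] at hm
    exact Word.twistedGE_mul.2
      (h.support.2 _ ((map_ne_zero_iff _ (rename_injective_perm v)).1 hm))
  · rw [twist_apply, hl, h.value]
    exact rename_invProd v u l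
  · rw [twist_apply, totalDegree_rename_perm, h.degree _ (Word.twistedGE_mul.1 hm), Word.act_act,
      mul_inv_rev, mul_assoc, inv_mul_cancel, mul_one]

theorem Word.twistedGE_one {m l : Word N n} : Word.twistedGE 1 m l ↔ Word.GE m l := by
  unfold Word.twistedGE
  rw [inv_one, Word.act_one, Word.act_one]

theorem isTwistedSchubertClass_schubert (l : Word N n) :
    IsTwistedSchubertClass 1 l (schubert l) := by
  have h := isSchubert_schubert l
  refine ⟨h.mem, ⟨?_, fun m hm => Word.twistedGE_one.2 (h.support m hm)⟩, h.value, fun m hm => ?_⟩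
  · rw [h.value]; exact invProd_ne_zero 1 l
  · rw [totalDegree_schubert (Word.twistedGE_one.1 hm), inv_one, Word.act_one]

theorem IsTwistedSchubertClass.isSchubert {l : Word N n} {α : Word N n → P N}
    (h : IsTwistedSchubertClass 1 l α) : IsSchubert l α := by
  refine ⟨h.isClass, fun m hm => Word.twistedGE_one.1 (h.support.2 m hm), h.value, fun m => ?_⟩
  rcases eq_or_ne (α m) 0 with h0 | h0
  · simp [h0]
  · rw [h.degree m (h.support.2 m h0), inv_one, Word.act_one]

theorem isTwistedSchubertClass_twist_schubert (w : Equiv.Perm (Fin N)) (l : Word N n) :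
    IsTwistedSchubertClass w l (twist w (schubert (Word.act w⁻¹ l))) := by
  have := (isTwistedSchubertClass_schubert (Word.act w⁻¹ l)).twist w
  rwa [mul_one, Word.act_act, mul_inv_cancel, Word.act_one] at this

theorem IsTwistedSchubertClass.eq_twist {w : Equiv.Perm (Fin N)} {l : Word N n}
    {α : Word N n → P N} (h : IsTwistedSchubertClass w l α) :
    α = WallCrossing.twist w (schubert (Word.act w⁻¹ l)) := by
  have h1 := h.twist w⁻¹
  rw [inv_mul_cancel] at h1
  rw [← h1.isSchubert.unique (isSchubert_schubert _), twist_twist, mul_inv_cancel, twist_one]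

theorem isTwistedSchubertClass_S (w : Equiv.Perm (Fin N)) (l : Word N n) :
    IsTwistedSchubertClass w l (S w l) :=
  Classical.epsilon_spec (p := fun α => IsTwistedSchubertClass w l α)
    ⟨_, isTwistedSchubertClass_twist_schubert w l⟩

theorem S_eq_twist (w : Equiv.Perm (Fin N)) (l : Word N n) :
    S w l = twist w (schubert (Word.act w⁻¹ l)) :=
  (isTwistedSchubertClass_S w l).eq_twist

/-- Wall-crossing for twisted Schubert classes. -/
theorem S_mul_swap (w : Equiv.Perm (Fin N)) {i j : Fin N} (hij : (i : ℕ) + 1 = j)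
    (l m : Word N n) :
    S (w * Equiv.swap i j) l m =
      S w (Word.act (w * Equiv.swap i j * w⁻¹) l) m +
        if l.1 (w i) < l.1 (w j) then
          (MvPolynomial.X (w j) - MvPolynomial.X (w i)) * S w l m else 0 := by
  have h := congrArg (MvPolynomial.rename w)
    (twist_schubert_swap hij (Word.act w⁻¹ l) (Word.act w⁻¹ m))
  rw [← twist_apply, twist_twist, map_add, ← twist_apply] at h
  have e1 : Word.act (w * Equiv.swap i j)⁻¹ l = Word.act (Equiv.swap i j) (Word.act w⁻¹ l) := by
    rw [Word.act_act, mul_inv_rev, Equiv.swap_inv]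
  have e2 : Word.act w⁻¹ (Word.act (w * Equiv.swap i j * w⁻¹) l)
      = Word.act (Equiv.swap i j) (Word.act w⁻¹ l) := by
    rw [Word.act_act, Word.act_act]
    simp [mul_assoc]
  have e3 : ∀ k, (Word.act w⁻¹ l).1 k = l.1 (w k) := fun k => by
    rw [Word.act_apply, inv_inv]
  rw [S_eq_twist, S_eq_twist, S_eq_twist, e1, e2, h, e3, e3]
  congr 1
  split_ifs
  · rw [map_mul, map_sub, MvPolynomial.rename_X, MvPolynomial.rename_X, twist_apply]
  · rw [map_zero]

/-! ### Bases -/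

theorem S_apply_self_ne_zero (w : Equiv.Perm (Fin N)) (l : Word N n) : S w l l ≠ 0 :=
  (isTwistedSchubertClass_S w l).support.1

theorem S_apply_eq_zero {w : Equiv.Perm (Fin N)} {l m : Word N n}
    (h : (Word.act w⁻¹ m).length ≤ (Word.act w⁻¹ l).length) (hne : m ≠ l) : S w l m = 0 := by
  by_contra h0
  have h1 := ((isTwistedSchubertClass_S w l).support.2 m h0).eq_of_length_le h
  have h2 := congrArg (Word.act w) h1
  rw [Word.act_act, Word.act_act, mul_inv_cancel, Word.act_one, Word.act_one] at h2
  exact hne h2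

/-- This makes triangular elimination possible over `P` although the diagonal entries are not units.
-/
theorem S_apply_self_dvd (w : Equiv.Perm (Fin N)) {α : Word N n → P N} (hα : α ∈ HT N n)
    {m : Word N n}
    (h : ∀ m', (Word.act w⁻¹ m').length < (Word.act w⁻¹ m).length → α m' = 0) :
    S w m m ∣ α m := by
  have h1 := HT.invProd_dvd (twist_mem w⁻¹ hα) (l := Word.act w⁻¹ m) fun m' hm' => by
    have e : Word.act w⁻¹ (Word.act w m') = m' := by
      rw [Word.act_act, inv_mul_cancel, Word.act_one]
    rw [twist_apply, inv_inv, h _ (by rwa [e]), map_zero]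
  have h2 := map_dvd (MvPolynomial.rename w) h1
  rw [← twist_apply w (twist w⁻¹ α), twist_twist, mul_inv_cancel, twist_one] at h2
  rwa [S_eq_twist, twist_apply, (isSchubert_schubert _).value]

/-- The twisted Schubert class as an element of the equivariant cohomology. -/
noncomputable def SClass (w : Equiv.Perm (Fin N)) (l : Word N n) : HT N n :=
  ⟨S w l, (isTwistedSchubertClass_S w l).isClass⟩

theorem coe_sum_smul_SClass_apply (w : Equiv.Perm (Fin N)) (s : Finset (Word N n))
    (c : Word N n → P N) (m : Word N n) :
    ((∑ l ∈ s, c l • SClass w l : HT N n) : Word N n → P N) m = ∑ l ∈ s, c l * S w l m := by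
  rw [Submodule.coe_sum, Finset.sum_apply]
  rfl

theorem linearIndependent_SClass (w : Equiv.Perm (Fin N)) :
    LinearIndependent (P N) (SClass w : Word N n → HT N n) := by
  rw [Fintype.linearIndependent_iff]
  intro c hc
  have key : ∀ k : ℕ, ∀ l : Word N n, (Word.act w⁻¹ l).length = k → c l = 0 := fun k => by
    induction k using Nat.strong_induction_on with
    | _ k ih =>
      intro l hl
      have h := coe_sum_smul_SClass_apply w Finset.univ c l
      rw [hc, Finset.sum_eq_single l (fun l' _ hne => ?_) (by simp)] at h
      · exact (mul_eq_zero.1 h.symm).resolve_right (S_apply_self_ne_zero w l)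
      -- Shorter words have coefficient zero by induction; other words of at least this length have
      -- classes vanishing at `l`.
      · rcases lt_or_ge (Word.act w⁻¹ l').length k with h' | h'
        · rw [ih _ h' l' rfl, zero_mul]
        · rw [S_apply_eq_zero (hl.trans_le h') hne.symm, mul_zero]
  exact fun l => key _ l rfl

theorem span_SClass (w : Equiv.Perm (Fin N)) :
    ⊤ ≤ Submodule.span (P N) (Set.range (SClass w : Word N n → HT N n)) := by
  set K := Fintype.card (Fin N × Fin N)
  have hK : ∀ l : Word N n, l.length ≤ K := fun l => Finset.card_le_univ _
  -- Induction on the number `d` of top length layers on which `x` may be nonzero.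
  have key : ∀ d : ℕ, ∀ x : HT N n,
      (∀ m, (Word.act w⁻¹ m).length + d ≤ K → (x : Word N n → P N) m = 0) →
      x ∈ Submodule.span (P N) (Set.range (SClass w : Word N n → HT N n)) := fun d => by
    induction d with
    | zero =>
      intro x hx
      have : x = 0 := Subtype.ext (funext fun m => hx m (hK _))
      rw [this]
      exact zero_mem _
    | succ d ih =>
      intro x hx
      -- Quotients matter only on the lowest remaining layer, of length `K - d`; the value `0`
      -- elsewhere just makes `q` total. Classes within one layer vanish at each other's words, so
      -- the whole layer is cleared at once.
      have hdvd : ∀ m, ∃ q : P N, (Word.act w⁻¹ m).length + d = K →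
          (x : Word N n → P N) m = S w m m * q := fun m => by
        by_cases hm : (Word.act w⁻¹ m).length + d = K
        · obtain ⟨q, hq⟩ := S_apply_self_dvd w x.2 (m := m) fun m' hm' => hx m' (by omega)
          exact ⟨q, fun _ => hq⟩
        · exact ⟨0, fun h => absurd h hm⟩
      choose q hq using hdvd
      set L : Finset (Word N n) := Finset.univ.filter fun m => (Word.act w⁻¹ m).length + d = K
      have hsum : ∑ l ∈ L, q l • SClass w l ∈
          Submodule.span (P N) (Set.range (SClass w : Word N n → HT N n)) :=
        Submodule.sum_mem _ fun l _ =>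
          Submodule.smul_mem _ _ (Submodule.subset_span (Set.mem_range_self l))
      rw [← Submodule.sub_mem_iff_left _ hsum]
      refine ih _ fun m hm => ?_
      rw [Submodule.coe_sub, Pi.sub_apply, coe_sum_smul_SClass_apply]
      have hz : ∀ l ∈ L, l ≠ m → q l * S w l m = 0 := fun l hl hne => by
        have := (Finset.mem_filter.1 hl).2
        rw [S_apply_eq_zero (by omega) hne.symm, mul_zero]
      rcases hm.lt_or_eq with hm | hm
      · rw [hx m (by omega), Finset.sum_eq_zero, sub_zero]
        intro l hl
        refine hz l hl ?_
        rintro rfl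
        have := (Finset.mem_filter.1 hl).2
        omega
      · rw [Finset.sum_eq_single m hz, hq m hm]
        · ring
        · intro h; exact absurd (Finset.mem_filter.2 ⟨Finset.mem_univ m, hm⟩) h
  intro x _
  -- With `d = K + 1` the vanishing condition is empty.
  exact key (K + 1) x fun m hm => by omega

/-- The basis of twisted Schubert classes. -/
noncomputable def schubertBasis (w : Equiv.Perm (Fin N)) :
    Module.Basis (Word N n) (P N) (HT N n) :=
  Module.Basis.mk (linearIndependent_SClass w) (span_SClass w)

theorem schubertBasis_apply (w : Equiv.Perm (Fin N)) (l : Word N n) :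
    schubertBasis w l = SClass w l := Module.Basis.mk_apply _ _ l

theorem schubertBasis_mul_swap (w : Equiv.Perm (Fin N)) {i j : Fin N} (hij : (i : ℕ) + 1 = j)
    (l : Word N n) :
    schubertBasis (w * Equiv.swap i j) l =
      schubertBasis w (Word.act (w * Equiv.swap i j * w⁻¹) l) +
        (if l.1 (w i) < l.1 (w j) then MvPolynomial.X (w j) - MvPolynomial.X (w i) else 0 : P N) •
          schubertBasis w l := by
  simp only [schubertBasis_apply]
  refine Subtype.ext (funext fun m => (S_mul_swap w hij l m).trans ?_)
  split_ifs
  · rfl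
  · rw [zero_smul, add_zero, add_zero]; rfl

theorem sum_repr_smul {ι R M M' : Type*} [Fintype ι] [CommRing R] [AddCommGroup M]
    [Module R M] [AddCommGroup M'] [Module R M'] (b : Module.Basis ι R M) (v : ι → M') (k l : ι)
    (c : R) : ∑ m, b.repr (b k + c • b l) m • v m = v k + c • v l := by
  classical
  simp [Finsupp.single_apply, add_smul, Finset.sum_add_distrib, ite_smul]

/-! ### The action of the `R`-matrix -/

theorem toLin'_single_apply (k p x : Fin 2) :
    Matrix.toLin' (Matrix.single k p (1 : P N)) (Pi.basisFun (P N) (Fin 2) x) =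
      if x = p then Pi.basisFun (P N) (Fin 2) k else 0 := by
  rw [Pi.basisFun_apply, Matrix.toLin'_apply, Matrix.mulVec_single_one]
  ext y
  split_ifs with h
  · subst h; simp [Matrix.single_apply, Pi.single_apply, eq_comm]
  · simp [Ne.symm h]

theorem onFactors_stdBasis {a b : Fin N} (hab : a ≠ b) (k l p q : Fin 2) (f : Fin N → Fin 2) :
    onFactors a b (Matrix.toLin' (Matrix.single k p (1 : P N)))
        (Matrix.toLin' (Matrix.single l q (1 : P N))) (stdBasis N f) =
      if f a = p ∧ f b = q then
        stdBasis N (Function.update (Function.update f a k) b l) else 0 := by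
  rw [onFactors, stdBasis, Basis.piTensorProduct_apply, PiTensorProduct.map_tprod]
  split_ifs with h
  · rw [Basis.piTensorProduct_apply]
    congr 1
    funext c
    rcases eq_or_ne c b with rfl | hb
    · rw [if_neg hab.symm, if_pos rfl, toLin'_single_apply, if_pos h.2, Function.update_self]
    rw [Function.update_of_ne hb]
    rcases eq_or_ne c a with rfl | ha
    · rw [if_pos rfl, toLin'_single_apply, if_pos h.1, Function.update_self]
    · rw [if_neg ha, if_neg hb, Function.update_of_ne ha, LinearMap.id_apply]
  · rcases not_and_or.1 h with h | h
    · refine MultilinearMap.map_coord_zero _ a ?_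
      rw [if_pos rfl, toLin'_single_apply, if_neg h]
    · refine MultilinearMap.map_coord_zero _ b ?_
      rw [if_neg hab.symm, if_pos rfl, toLin'_single_apply, if_neg h]

theorem actOnFactors_stdBasis {a b : Fin N} (hab : a ≠ b)
    (M : Matrix (Fin 2 × Fin 2) (Fin 2 × Fin 2) (P N)) (f : Fin N → Fin 2) :
    actOnFactors a b M (stdBasis N f) = ∑ k : Fin 2, ∑ l : Fin 2,
      M (k, l) (f a, f b) • stdBasis N (Function.update (Function.update f a k) b l) := by
  simp only [actOnFactors, LinearMap.sum_apply, LinearMap.smul_apply, onFactors_stdBasis hab]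
  refine Finset.sum_congr rfl fun k _ => Finset.sum_congr rfl fun l _ => ?_
  rw [Finset.sum_eq_single (f a), Finset.sum_eq_single (f b)]
  · simp
  · intro q _ hq; simp [hq.symm]
  · simp
  · intro p _ hp; simp [hp.symm]
  · simp

theorem update_update_self {a b : Fin N} (f : Fin N → Fin 2) :
    Function.update (Function.update f a (f a)) b (f b) = f := by simp

theorem Word.update_eq_swap {a b : Fin N} (l : Word N n) :
    Function.update (Function.update l.1 a (l.1 b)) b (l.1 a) =
      (Word.act (Equiv.swap a b) l).1 := by
  funext c
  rcases eq_or_ne c b with rfl | hb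
  · rw [Function.update_self, Word.swap_right]
  rw [Function.update_of_ne hb]
  rcases eq_or_ne c a with rfl | ha
  · rw [Function.update_self, Word.swap_left]
  · rw [Function.update_of_ne ha, Word.act_apply, Equiv.swap_inv,
      Equiv.swap_apply_of_ne_of_ne ha hb]

/-- `R` is the flip of two factors plus `x - y` on `v_0 ⊗ v_1`; on equal letters the flip is the
identity. This is the shape of the wall-crossing formula. -/
theorem RMatrix_stdBasis {a b : Fin N} (hab : a ≠ b) (x y : P N) (l : Word N n) :
    actOnFactors a b (RMatrix x y) (stdBasis N l.1) =
      stdBasis N (Word.act (Equiv.swap a b) l).1 +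
        (if l.1 a < l.1 b then x - y else 0 : P N) • stdBasis N l.1 := by
  have h1 := update_update_self (a := a) (b := b) l.1
  have h2 := l.update_eq_swap (a := a) (b := b)
  rw [actOnFactors_stdBasis hab]
  have e00 : finProdFinEquiv ((0, 0) : Fin 2 × Fin 2) = 0 := rfl
  have e01 : finProdFinEquiv ((0, 1) : Fin 2 × Fin 2) = 1 := rfl
  have e10 : finProdFinEquiv ((1, 0) : Fin 2 × Fin 2) = 2 := rfl
  have e11 : finProdFinEquiv ((1, 1) : Fin 2 × Fin 2) = 3 := rfl
  simp only [Fin.sum_univ_two, RMatrix, Matrix.submatrix_apply]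
  rcases l.letter_cases a with ha | ha <;> rcases l.letter_cases b with hb | hb <;>
    rw [ha, hb] at h1 h2 <;> rw [ha, hb] <;> rw [e00, e01, e10, e11]
  · rw [h1, Word.swap_eq_self (ha.trans hb.symm)]; simp
  · rw [h1, h2]; simp [add_comm]
  · rw [h2]; simp
  · rw [h1, Word.swap_eq_self (ha.trans hb.symm)]; simp

end

end WallCrossing

theorem proposition3p6 (N n : ℕ) (hN : 2 ≤ N) (hn : n ≤ N) :
    -- the twisted Schubert classes are well defined
    (∀ (w : Equiv.Perm (Fin N)) (l : WallCrossing.Word N n),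
      WallCrossing.IsTwistedSchubertClass w l (WallCrossing.S w l) ∧
      ∀ α : WallCrossing.Word N n → WallCrossing.P N,
        WallCrossing.IsTwistedSchubertClass w l α → α = WallCrossing.S w l) ∧
    -- wall-crossing for the simple transposition exchanging `i` and `j = i + 1`
    (∀ (w : Equiv.Perm (Fin N)) (i j : Fin N), (i : ℕ) + 1 = (j : ℕ) →
      ∀ l m : WallCrossing.Word N n,
        WallCrossing.S (w * Equiv.swap i j) l m =
          if l.1 (w i) < l.1 (w j) then
            WallCrossing.S w (WallCrossing.Word.act (w * Equiv.swap i j * w⁻¹) l) m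
              + (MvPolynomial.X (w j) - MvPolynomial.X (w i)) * WallCrossing.S w l m
          else
            WallCrossing.S w (WallCrossing.Word.act (w * Equiv.swap i j * w⁻¹) l) m) ∧
    -- every twisted family is a basis, and the base change is given by the `R`-matrix
    (∃ b : Equiv.Perm (Fin N) →
        Module.Basis (WallCrossing.Word N n) (WallCrossing.P N) (WallCrossing.HT N n),
      (∀ (w : Equiv.Perm (Fin N)) (l : WallCrossing.Word N n),
        ((b w l : WallCrossing.HT N n) : WallCrossing.Word N n → WallCrossing.P N)
          = WallCrossing.S w l) ∧
      (∀ (w : Equiv.Perm (Fin N)) (i j : Fin N), (i : ℕ) + 1 = (j : ℕ) →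
        ∀ l : WallCrossing.Word N n,
          WallCrossing.actOnFactors (w i) (w j)
              (WallCrossing.RMatrix (MvPolynomial.X (w j)) (MvPolynomial.X (w i)))
              (WallCrossing.stdBasis N l.1)
            = ∑ m : WallCrossing.Word N n,
                (b w).toMatrix (b (w * Equiv.swap i j)) m l • WallCrossing.stdBasis N m.1)) := by
  refine ⟨fun w l => ⟨WallCrossing.isTwistedSchubertClass_S w l, fun α hα => ?_⟩,
    fun w i j hij l m => ?_, WallCrossing.schubertBasis, fun w l => ?_, fun w i j hij l => ?_⟩
  · rw [hα.eq_twist, WallCrossing.S_eq_twist]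
  · rw [WallCrossing.S_mul_swap w hij]
    split_ifs
    · rfl
    · rw [add_zero]
  · rw [WallCrossing.schubertBasis_apply]; rfl
  · simp only [Module.Basis.toMatrix_apply, WallCrossing.schubertBasis_mul_swap w hij]
    refine Eq.trans ?_ (WallCrossing.sum_repr_smul (WallCrossing.schubertBasis w)
      (fun m : WallCrossing.Word N n => WallCrossing.stdBasis N m.1) _ l _).symm
    -- The conjugate of the swap of `i, j` by `w` is the swap of `w i, w j`, which identifies the
    -- two leading terms.
    rw [WallCrossing.RMatrix_stdBasis (w.injective.ne (WallCrossing.adj_lt hij).ne),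
      Equiv.mul_swap_eq_swap_mul, mul_inv_cancel_right]
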